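/- For a group $G$ and an endomorphism $\varphi$ of $G$, elements $x,y\in G$ are called $\varphi$-conjugate if $x=zy\varphi(z)^{-1}$ for some $z\in G$. The Reidemeister number $R(\varphi)\in\{1,2,\dots\}\cup\{\infty\}$ is the number of classes of this equivalence relation, all infinite cardinals being denoted by $\infty$. The Reidemeister spectrum of $G$ is $\mathrm{Spec}_R(G)=\{R(\varphi) : \varphi\in\mathrm{Aut}(G)\}$, and $G$ has the $R_\infty$-property if $\mathrm{Spec}_R(G)=\{\infty\}$. **Theorem.** Let $F$ be an algebraically closed field of characteristic zero with infinite transcendence degree over $\mathbb{Q}$, and let $n\ge 2$. Then there is a field automorphism $\sigma$ of $F$ such that the automorphism of $\mathrm{GL}_n(F)$ and the automorphism of $\mathrm{SL}_n(F)$ given by applying $\sigma$ to every matrix entry both have Reidemeister number $1$. In particular $1\in\mathrm{Spec}_R(\mathrm{GL}_n(F))$ and $1\in\mathrm{Spec}_R(\mathrm{SL}_n(F))$, and neither $\mathrm{GL}_n(F)$ nor $\mathrm{SL}_n(F)$ has the $R_\infty$-property. -/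

import Mathlib

section TwistedConjugacy

variable {G : Type*} [Group G]

/-- `x` and `y` are `φ`-conjugated if `x = z * y * φ(z)⁻¹` for some `z` in `G`. -/
def TwistedConj (φ : G →* G) (x y : G) : Prop :=
  ∃ z : G, x = z * y * (φ z)⁻¹

theorem twistedConj_equivalence (φ : G →* G) : Equivalence (TwistedConj φ) where
  refl x := ⟨1, by simp⟩
  symm := by
    rintro x y ⟨z, rfl⟩
    exact ⟨z⁻¹, by simp [mul_assoc]⟩
  trans := by
    rintro x y w ⟨z, rfl⟩ ⟨v, rfl⟩
    exact ⟨z * v, by simp [mul_assoc]⟩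

/-- The equivalence relation of `φ`-conjugation on `G`. -/
def twistedConjSetoid (φ : G →* G) : Setoid G :=
  ⟨TwistedConj φ, twistedConj_equivalence φ⟩

/-- The Reidemeister number of an endomorphism `φ`: the number of `φ`-conjugacy classes,
all infinite cardinals being identified with `∞ = ⊤`. -/
noncomputable def reidemeisterNumber (φ : G →* G) : ℕ∞ :=
  ENat.card (Quotient (twistedConjSetoid φ))

variable (G) in
/-- The Reidemeister spectrum of `G`: the Reidemeister numbers of all automorphisms of `G`. -/
def reidemeisterSpectrum : Set ℕ∞ :=
  {r | ∃ φ : G ≃* G, reidemeisterNumber φ.toMonoidHom = r}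

variable (G) in
/-- `G` has the `R_∞`-property if its Reidemeister spectrum is `{∞}`. -/
def HasRInfinity : Prop :=
  reidemeisterSpectrum G = {⊤}

end TwistedConjugacy

section FieldAutomorphism

variable {F : Type*} [Field F]

/-- The automorphism of `GL_n(F)` that applies a field automorphism to every entry. -/
def glFieldAut (n : ℕ) (σ : F ≃+* F) :
    Matrix.GeneralLinearGroup (Fin n) F ≃* Matrix.GeneralLinearGroup (Fin n) F :=
  (Matrix.GeneralLinearGroup.map (σ : F →+* F)).toMulEquiv
    (Matrix.GeneralLinearGroup.map (σ.symm : F →+* F))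
    (by ext; simp) (by ext; simp)

/-- The automorphism of `SL_n(F)` that applies a field automorphism to every entry. -/
def slFieldAut (n : ℕ) (σ : F ≃+* F) :
    Matrix.SpecialLinearGroup (Fin n) F ≃* Matrix.SpecialLinearGroup (Fin n) F :=
  (Matrix.SpecialLinearGroup.map (σ : F →+* F)).toMulEquiv
    (Matrix.SpecialLinearGroup.map (σ.symm : F →+* F))
    (by ext; simp) (by ext; simp)

end FieldAutomorphism

/-!
An automorphism `φ` of `G` has Reidemeister number `1` exactly when every `A` in `G` has the form
`Z * (φ Z)⁻¹`, so what is needed is a field automorphism `σ` of `F` for which the equation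
`A * σ(Z) = Z` has an invertible solution `Z` for every `A` in `GL_n(F)`. Such a `σ` is produced by
adjoining generic solutions.

*Adjoining solutions.* Given an automorphism `σ` of a field `k`, take for each `A` in `GL_n(k)` a
matrix `X_A` of independent variables, and extend `σ` to the polynomial ring in all of them by
`X_A ↦ A⁻¹ * X_A` (`genericAut`). This is again an automorphism, its inverse being
`X_A ↦ σ⁻¹(A) * X_A`, so it extends to an algebraic closure `L` of the fraction field. In `L` each
`X_A` is invertible and solves the equation for `A` (`exists_isAlgClosed_trivializes`).

*Staying inside `F`.* An algebraically closed field of characteristic zero and infinite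
transcendence degree over `ℚ` has cardinality equal to its transcendence degree. By Steinitz, every
algebraically closed field containing `F` and no larger than `F` is therefore isomorphic to `F`
(`IsAlgClosed.nonempty_ringEquiv_of_embedding`). This applies to `L`, so adjoining solutions is an
operation on automorphisms of `F` (`exists_selfEmbedding_trivializes`).

*Closing up.* Iterating gives a tower `F → F → ⋯` with compatible automorphisms, in which every
equation over one level is solved at the next. Its direct limit is algebraically closed, no larger
than `F`, and closed under solving the equations (`exists_limit_of_tower`); it is again isomorphic
to `F`, and the limit automorphism is carried over to `F`.

*The special linear group.* If `A` has determinant `1` and `A * σ(Z) = Z`, then `σ` fixes `det Z`,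
so multiplying `Z` on the right by the `σ`-invariant matrix `diag((det Z)⁻¹, 1, …, 1)` gives a
solution of determinant `1`.
-/

/-! ### Algebraically closed fields of infinite transcendence degree -/

universe u v

open Cardinal in
theorem IsAlgClosed.mk_eq_trdeg_rat {F : Type*} [Field F] [IsAlgClosed F] [CharZero F]
    (htr : ℵ₀ ≤ Algebra.trdeg ℚ F) : #F = Algebra.trdeg ℚ F := by
  obtain ⟨s, hs⟩ := exists_isTranscendenceBasis ℚ F
  have hcard : #s = Algebra.trdeg ℚ F := hs.cardinalMk_eq_trdeg
  refine le_antisymm ?_ (hcard ▸ mk_set_le s)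
  have h := IsAlgClosed.cardinal_le_max_transcendence_basis (R := ℚ) _ hs
  simpa [hcard, htr] using h

open Cardinal in
/-- An algebraically closed field that contains `F` and is no larger than `F` is isomorphic to `F`,
provided `F` has infinite transcendence degree. The embedding is what handles countable `F`, where
cardinality alone does not determine the transcendence degree. -/
theorem IsAlgClosed.nonempty_ringEquiv_of_embedding {F : Type u} {L : Type v} [Field F]
    [IsAlgClosed F] [CharZero F] [Field L] [IsAlgClosed L] (htr : ℵ₀ ≤ Algebra.trdeg ℚ F) (ι : F →+* L)
    (hL : Cardinal.lift.{u} #L ≤ Cardinal.lift.{v} #F) : Nonempty (F ≃+* L) := by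
  have : CharZero L := charZero_of_injective_ringHom ι.injective
  obtain ⟨s, hs⟩ := exists_isTranscendenceBasis ℚ F
  obtain ⟨t, ht⟩ := exists_isTranscendenceBasis ℚ L
  have hle := lift_trdeg_le_of_injective ι.toRatAlgHom ι.injective
  have hst : Cardinal.lift.{v} #s = Cardinal.lift.{u} #t := by
    rw [hs.cardinalMk_eq_trdeg, ht.cardinalMk_eq_trdeg]
    refine le_antisymm hle (le_trans ?_ (hL.trans_eq (by rw [mk_eq_trdeg_rat htr])))
    rw [← ht.cardinalMk_eq_trdeg]
    exact lift_le.2 (mk_set_le t)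
  obtain ⟨e⟩ := lift_mk_eq'.1 hst
  exact ⟨IsAlgClosed.equivOfTranscendenceBasis _ _ e hs ht⟩

open Matrix

/-! ### Matrices that become twisted-conjugate to the identity -/

section Trivializes

variable {k L M m : Type*} [Field k] [Field L] [Field M] [Fintype m] [DecidableEq m]

/-- Every invertible matrix over `k`, mapped to `L` along `ι`, has the form `Z * τ(Z)⁻¹` with `Z`
invertible over `L`. For `ι` the identity of `k` this says that every invertible matrix is
`τ`-conjugate to `1`. -/
def Trivializes (m : Type*) [Fintype m] [DecidableEq m] (ι : k →+* L) (τ : L →+* L) : Prop :=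
  ∀ A : GL m k, ∃ Z : GL m L, GeneralLinearGroup.map ι A = Z * (GeneralLinearGroup.map τ Z)⁻¹

theorem Trivializes.comp {ι : k →+* L} {τ : L →+* L} (h : Trivializes m ι τ) (g : L →+* M)
    {ρ : M →+* M} (hg : ∀ x, ρ (g x) = g (τ x)) : Trivializes m (g.comp ι) ρ := by
  intro A
  obtain ⟨Z, hZ⟩ := h A
  refine ⟨GeneralLinearGroup.map g Z, ?_⟩
  have hcomm : GeneralLinearGroup.map ρ (GeneralLinearGroup.map g Z) =
      GeneralLinearGroup.map g (GeneralLinearGroup.map τ Z) := by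
    ext i j
    exact hg (Z i j)
  rw [hcomm, ← map_inv, ← map_mul, ← hZ]
  rfl

/-- The same condition as a linear equation between matrices. -/
theorem trivializes_of_exists_mul_map_eq {ι : k →+* L} {τ : L →+* L}
    (h : ∀ A : GL m k, ∃ Z : Matrix m m L, Z.det ≠ 0 ∧ (A : Matrix m m k).map ι * Z.map τ = Z) :
    Trivializes m ι τ := by
  intro A
  obtain ⟨Z, hdet, hZ⟩ := h A
  refine ⟨GeneralLinearGroup.mkOfDetNeZero Z hdet, ?_⟩
  rw [eq_mul_inv_iff_mul_eq]
  exact Units.ext hZ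

end Trivializes

/-! ### Adjoining generic solutions -/

section Generic

open Cardinal in
/-- An automorphism of a domain extends to an algebraically closed field containing it, and one no
larger than the domain when the domain is infinite. -/
theorem exists_isAlgClosed_extension {R : Type u} [CommRing R] [IsDomain R] (α : R ≃+* R) :
    ∃ (L : Type u) (_ : Field L) (_ : IsAlgClosed L) (j : R →+* L) (τ : L ≃+* L),
      Function.Injective j ∧ (∀ x, τ (j x) = j (α x)) ∧ #L ≤ max #R ℵ₀ := by
  let Q := FractionRing R
  let L := AlgebraicClosure Q
  let ρ : Q ≃+* Q := IsFractionRing.ringEquivOfRingEquiv α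
  refine ⟨L, inferInstance, inferInstance, (algebraMap Q L).comp (algebraMap R Q),
    IsAlgClosure.equivOfEquiv L L ρ,
    (algebraMap Q L).injective.comp (IsFractionRing.injective R Q), fun x => ?_, ?_⟩
  · simp only [RingHom.comp_apply, IsAlgClosure.equivOfEquiv_algebraMap]
    exact congrArg _ (IsFractionRing.ringEquivOfRingEquiv_algebraMap _ _)
  · exact (Algebra.IsAlgebraic.cardinalMk_le_max Q L).trans
      (max_le_max (IsLocalization.cardinalMk_le (nonZeroDivisors R)) le_rfl)

variable {k : Type u} [Field k] {m : Type} [Fintype m] [DecidableEq m]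

/-- The polynomial ring over `k` with one `m × m` block of variables for each `A` in `GL m k`. -/
abbrev GenericRing (k : Type u) [Field k] (m : Type) [Fintype m] [DecidableEq m] : Type u :=
  MvPolynomial (GL m k × m × m) k

/-- The matrix of variables in the block of `A`. -/
noncomputable def genericMatrix (A : GL m k) : Matrix m m (GenericRing k m) :=
  Matrix.of fun i j => MvPolynomial.X (A, i, j)

theorem det_genericMatrix_ne_zero (A : GL m k) : (genericMatrix A).det ≠ 0 := by
  intro h
  -- specialise the generic matrix to the identity
  have h1 := congrArg (MvPolynomial.eval fun q : GL m k × m × m => (1 : Matrix m m k) q.2.1 q.2.2) h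
  have h2 : (MvPolynomial.eval fun q : GL m k × m × m =>
      (1 : Matrix m m k) q.2.1 q.2.2).mapMatrix (genericMatrix A) = 1 := by
    ext i j
    simp [genericMatrix]
  rw [RingHom.map_det, h2] at h1
  simp at h1

/-- The `σ`-semilinear endomorphism of the polynomial ring that multiplies the generic matrix of `A`
on the left by `c A`. -/
noncomputable def genericTwist (σ : k →+* k) (c : GL m k → Matrix m m k) :
    GenericRing k m →+* GenericRing k m :=
  MvPolynomial.eval₂Hom (MvPolynomial.C.comp σ) fun q =>
    ((c q.1).map MvPolynomial.C * genericMatrix q.1 : Matrix m m (GenericRing k m)) q.2.1 q.2.2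

theorem genericTwist_C (σ : k →+* k) (c : GL m k → Matrix m m k) (x : k) :
    genericTwist σ c (MvPolynomial.C x) = MvPolynomial.C (σ x) := by
  simp [genericTwist]

theorem map_genericTwist_genericMatrix (σ : k →+* k) (c : GL m k → Matrix m m k) (A : GL m k) :
    (genericMatrix A).map (genericTwist σ c) = (c A).map MvPolynomial.C * genericMatrix A := by
  ext1 i j
  simp [genericTwist, genericMatrix]

theorem genericTwist_comp_eq_id {σ τ : k →+* k} {c d : GL m k → Matrix m m k}
    (hστ : ∀ x, σ (τ x) = x) (hcd : ∀ A, (d A).map σ * c A = 1) :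
    (genericTwist σ c).comp (genericTwist τ d) = RingHom.id _ := by
  refine MvPolynomial.ringHom_ext (fun x => ?_) fun ⟨A, i, j⟩ => ?_
  · simp [genericTwist_C, hστ]
  · have h : ((genericMatrix A).map (genericTwist τ d)).map (genericTwist σ c) =
        genericMatrix A := by
      have hC : ((d A).map MvPolynomial.C).map (genericTwist σ c) =
          ((d A).map σ).map MvPolynomial.C := by
        ext1 i j
        simp [genericTwist_C]
      rw [map_genericTwist_genericMatrix, Matrix.map_mul, map_genericTwist_genericMatrix, hC,
        ← Matrix.mul_assoc, ← Matrix.map_mul, hcd, Matrix.map_one _ (map_zero _) (map_one _),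
        Matrix.one_mul]
    exact congrFun (congrFun h i) j

/-- The extension of `σ` that sends the generic matrix of `A` to `A⁻¹` times itself. Its inverse
extends `σ⁻¹` and multiplies that matrix by `σ⁻¹(A)`. -/
noncomputable def genericAut (m : Type) [Fintype m] [DecidableEq m] (σ : k ≃+* k) :
    GenericRing k m ≃+* GenericRing k m :=
  RingEquiv.ofRingHom (genericTwist (σ : k →+* k) fun A => ((A⁻¹ : GL m k) : Matrix m m k))
    (genericTwist (σ.symm : k →+* k) fun A => (A : Matrix m m k).map σ.symm)
    (genericTwist_comp_eq_id (by simp) fun A => by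
      simp [Matrix.map_map, Function.comp_def])
    (genericTwist_comp_eq_id (by simp) fun A => by
      refine (Matrix.map_mul (L := ((A⁻¹ : GL m k) : Matrix m m k)) (M := (A : Matrix m m k))
        (f := (σ.symm : k →+* k))).symm.trans ?_
      rw [← Units.val_mul, inv_mul_cancel, Units.val_one, Matrix.map_one _ (map_zero _) (map_one _)])

theorem genericAut_apply (σ : k ≃+* k) (p : GenericRing k m) :
    genericAut m σ p =
      genericTwist (σ : k →+* k) (fun A => ((A⁻¹ : GL m k) : Matrix m m k)) p := by
  rw [genericAut, RingEquiv.ofRingHom_apply]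

theorem genericAut_C (σ : k ≃+* k) (x : k) :
    genericAut m σ (MvPolynomial.C x) = MvPolynomial.C (σ x) := by
  rw [genericAut_apply, genericTwist_C, RingEquiv.coe_toRingHom]

theorem map_genericAut_genericMatrix (σ : k ≃+* k) (A : GL m k) :
    (genericMatrix A).map (genericAut m σ) =
      ((A⁻¹ : GL m k) : Matrix m m k).map MvPolynomial.C * genericMatrix A := by
  rw [show (genericAut m σ : GenericRing k m → GenericRing k m) = _ from
    funext (genericAut_apply σ), map_genericTwist_genericMatrix]

open Cardinal in
theorem mk_genericRing_le (k : Type u) [Field k] [Infinite k]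
    (m : Type) [Fintype m] [DecidableEq m] :
    #(GenericRing k m) ≤ #k := by
  have hk : ℵ₀ ≤ #k := aleph0_le_mk k
  have hm : lift.{u} #(m × m) < ℵ₀ := lift_lt_aleph0.2 (lt_aleph0_of_finite (m × m))
  have hGL : #(GL m k) ≤ #k := by
    have hM : #(Matrix m m k) = lift.{0} #k ^ lift.{u} #(m × m) := by
      rw [← mk_arrow]
      exact mk_congr ((Equiv.curry m m k).trans Matrix.of).symm
    refine (mk_le_of_injective (Units.val_injective (α := Matrix m m k))).trans ?_
    rw [hM, lift_uzero]
    exact pow_le hk hm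
  have hI : #(GL m k × m × m) ≤ #k := by
    rw [mk_prod, lift_uzero]
    exact mul_le_of_le hk hGL (hm.le.trans hk)
  exact MvPolynomial.cardinalMk_le_max.trans (max_le (max_le le_rfl hI) hk)

open Cardinal in
/-- The entries of the generic matrices live in an extension of `k` to which `σ` extends, and there
they solve all the equations `A * σ(Z) = Z` with `A` in `GL m k`. -/
theorem exists_isAlgClosed_trivializes [Infinite k] (σ : k ≃+* k) :
    ∃ (L : Type u) (_ : Field L) (_ : IsAlgClosed L) (ι : k →+* L) (τ : L ≃+* L),
      #L ≤ #k ∧ (∀ x, τ (ι x) = ι (σ x)) ∧ Trivializes m ι (τ : L →+* L) := by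
  obtain ⟨L, _, _, j, τ, hj, hτ, hcard⟩ := exists_isAlgClosed_extension (genericAut m σ)
  refine ⟨L, inferInstance, inferInstance, j.comp MvPolynomial.C, τ,
    hcard.trans (max_le (mk_genericRing_le k m) (aleph0_le_mk k)), fun x => ?_,
    trivializes_of_exists_mul_map_eq fun A => ⟨(genericMatrix A).map j, ?_, ?_⟩⟩
  · rw [RingHom.comp_apply, RingHom.comp_apply, hτ, genericAut_C]
  · rw [← RingHom.mapMatrix_apply, ← RingHom.map_det]
    exact (map_ne_zero_iff j hj).2 (det_genericMatrix_ne_zero A)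
  · have hZ : ((genericMatrix A).map j).map (τ : L →+* L) =
        ((genericMatrix A).map (genericAut m σ)).map j := by
      ext1 i j'
      exact hτ _
    have hA : (((A⁻¹ : GL m k) : Matrix m m k).map MvPolynomial.C).map j =
        ((A⁻¹ : GL m k) : Matrix m m k).map (j.comp MvPolynomial.C) := rfl
    rw [hZ, map_genericAut_genericMatrix, Matrix.map_mul, hA, ← Matrix.mul_assoc,
      ← Matrix.map_mul, ← Units.val_mul, mul_inv_cancel, Units.val_one,
      Matrix.map_one _ (map_zero _) (map_one _), Matrix.one_mul]

end Generic

/-! ### The tower and its limit -/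

section Tower

variable {F : Type u} [Field F] {m : Type} [Fintype m] [DecidableEq m]

open Cardinal in
/-- The extension solving all equations over `(F, σ)` can be realised on `F` itself, with another
automorphism `τ` and an embedding `ι` of `F` into itself. -/
theorem exists_selfEmbedding_trivializes (m : Type) [Fintype m] [DecidableEq m] [IsAlgClosed F]
    [CharZero F] (htr : ℵ₀ ≤ Algebra.trdeg ℚ F) (σ : F ≃+* F) :
    ∃ (ι : F →+* F) (τ : F ≃+* F),
      (∀ x, τ (ι x) = ι (σ x)) ∧ Trivializes m ι (τ : F →+* F) := by
  obtain ⟨L, _, _, ι, τ, hcard, hτ, htriv⟩ := exists_isAlgClosed_trivializes (m := m) σ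
  obtain ⟨e⟩ := IsAlgClosed.nonempty_ringEquiv_of_embedding htr ι (by simpa using hcard)
  refine ⟨(e.symm : L →+* F).comp ι, (e.trans τ).trans e.symm, fun x => by simp [hτ],
    htriv.comp _ fun x => by simp⟩

/-- The `k`-fold composite of the maps of the tower, starting at level `i`. -/
def towerMap (ι : ℕ → F →+* F) (i : ℕ) : ℕ → F →+* F
  | 0 => RingHom.id F
  | k + 1 => (ι (i + k)).comp (towerMap ι i k)

theorem towerMap_add (ι : ℕ → F →+* F) (i k l : ℕ) (x : F) :
    towerMap ι (i + k) l (towerMap ι i k x) = towerMap ι i (k + l) x := by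
  induction l with
  | zero => rfl
  | succ l ih => simp [towerMap, ih, ← add_assoc]

theorem towerMap_comm {ι : ℕ → F →+* F} {σ : ℕ → F ≃+* F}
    (h : ∀ i x, σ (i + 1) (ι i x) = ι i (σ i x)) (i k : ℕ) (x : F) :
    σ (i + k) (towerMap ι i k x) = towerMap ι i k (σ i x) := by
  induction k with
  | zero => rfl
  | succ k ih => simp [towerMap, ← ih, ← h, ← add_assoc]

theorem directedSystem_towerMap (ι : ℕ → F →+* F) :
    DirectedSystem (fun _ : ℕ => F) fun i j _ => towerMap ι i (j - i) where
  map_self i x := by simp [towerMap]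
  map_map i j l hij hjl x := by
    obtain ⟨a, rfl⟩ := Nat.exists_eq_add_of_le hij
    obtain ⟨b, rfl⟩ := Nat.exists_eq_add_of_le hjl
    have h₁ : l + a + b - (l + a) = b := by omega
    have h₂ : l + a + b - l = a + b := by omega
    simp [h₁, h₂, towerMap_add]

/-- The direct limit of a tower of automorphisms of `F`, with the properties that characterise it
for the argument: the elements of the limit, and the polynomials over it, come from finite levels. -/
theorem exists_colimit_of_tower (ι : ℕ → F →+* F) (σ : ℕ → F ≃+* F)
    (h : ∀ i x, σ (i + 1) (ι i x) = ι i (σ i x)) :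
    ∃ (K : Type u) (_ : Field K) (of : ℕ → F →+* K) (τ : K ≃+* K),
      (∀ i x, of (i + 1) (ι i x) = of i x) ∧ (∀ i x, τ (of i x) = of i (σ i x)) ∧
      (∀ z, ∃ i x, of i x = z) ∧ ∀ p : Polynomial K, ∃ i q, Polynomial.map (of i) q = p := by
  let f : ∀ i j : ℕ, i ≤ j → F →+* F := fun i j _ => towerMap ι i (j - i)
  have : DirectedSystem (fun _ : ℕ => F) (f · · ·) := directedSystem_towerMap ι
  have hf (i j : ℕ) (hij : i ≤ j) :
      (σ j).toRingHom.comp (f i j hij) = (f i j hij).comp (σ i) := by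
    ext x
    obtain ⟨a, rfl⟩ := Nat.exists_eq_add_of_le hij
    simpa [f] using towerMap_comm h i a x
  refine ⟨Ring.DirectLimit (fun _ : ℕ => F) (f · · ·), Field.DirectLimit.field (fun _ : ℕ => F) f,
    Ring.DirectLimit.of (fun _ : ℕ => F) (f · · ·),
    Ring.DirectLimit.congr (f := f) (f' := f) σ hf,
    fun i x => ?_, fun i x => Ring.DirectLimit.congr_apply_of (f := f) (f' := f) σ hf x,
    Ring.DirectLimit.exists_of, Ring.DirectLimit.Polynomial.exists_of (f' := f)⟩
  have hι : ι i x = f i (i + 1) (Nat.le_succ i) x := by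
    simp [f, towerMap]
  rw [hι]
  exact Ring.DirectLimit.of_f (f := (f · · ·)) (Nat.le_succ i) x

open Cardinal in
/-- If each step of a tower solves the equations over the previous level, then the limit solves its
own equations: a matrix over the limit comes from some level, and a solution appears one level
later. -/
theorem exists_limit_of_tower [IsAlgClosed F] (ι : ℕ → F →+* F) (σ : ℕ → F ≃+* F)
    (h : ∀ i x, σ (i + 1) (ι i x) = ι i (σ i x))
    (htriv : ∀ i, Trivializes m (ι i) (σ (i + 1) : F →+* F)) :
    ∃ (K : Type u) (_ : Field K) (_ : IsAlgClosed K) (_ : F →+* K) (τ : K ≃+* K),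
      #K ≤ #F ∧ Trivializes m (RingHom.id K) (τ : K →+* K) := by
  obtain ⟨K, _, of, τ, of_ι, hτ, exists_of, exists_poly⟩ := exists_colimit_of_tower ι σ h
  refine ⟨K, inferInstance, ?_, of 0, τ, ?_, fun A => ?_⟩
  · refine IsAlgClosed.of_exists_root K fun p _ hp => ?_
    obtain ⟨i, q, rfl⟩ := exists_poly p
    obtain ⟨x, hx⟩ := IsAlgClosed.exists_root q (by
      have := hp.degree_pos.ne'
      rwa [Polynomial.degree_map] at this)
    exact ⟨of i x, hx.map (f := of i)⟩
  · have hF : ℵ₀ ≤ #F := aleph0_le_mk F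
    -- the limit is a quotient of countably many copies of `F`
    have hsurj : Function.Surjective fun q : ULift.{u} ℕ × F => of q.1.down q.2 := fun z => by
      obtain ⟨i, x, hx⟩ := exists_of z
      exact ⟨(⟨i⟩, x), hx⟩
    refine (mk_le_of_surjective hsurj).trans ?_
    rw [mk_prod]
    simp [hF]
  · -- an element that comes from level `i` also comes from every later level
    have mono (i : ℕ) (x : F) (l : ℕ) : ∃ y, of (i + l) y = of i x := by
      induction l with
      | zero => exact ⟨x, rfl⟩
      | succ l ih =>
        obtain ⟨y, hy⟩ := ih
        exact ⟨ι (i + l) y, (of_ι _ _).trans hy⟩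
    choose s x hx using fun p : m × m => exists_of (A p.1 p.2)
    -- a level at which all entries of `A` are present
    let N := Finset.univ.sup s
    have hN (p : m × m) : ∃ y, of N y = A p.1 p.2 := by
      obtain ⟨l, hl⟩ := Nat.exists_eq_add_of_le (Finset.le_sup (f := s) (Finset.mem_univ p))
      obtain ⟨y, hy⟩ := mono (s p) (x p) l
      exact ⟨y, by rw [← hx p, ← hy]; congr 2⟩
    choose y hy using hN
    let B : Matrix m m F := Matrix.of fun i j => y (i, j)
    have hB : B.map (of N) = A := by
      ext i j
      exact hy (i, j)
    have hdet : B.det ≠ 0 := by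
      intro h0
      have hA := A.isUnit.map Matrix.detMonoidHom
      rw [← hB] at hA
      have := RingHom.map_det (of N) B
      rw [h0, map_zero] at this
      exact hA.ne_zero this.symm
    obtain ⟨Z, hZ⟩ := (htriv N).comp (of (N + 1)) (ρ := (τ : K →+* K)) (fun x => hτ _ x)
      (GeneralLinearGroup.mkOfDetNeZero B hdet)
    refine ⟨Z, Eq.trans ?_ hZ⟩
    ext i j
    exact ((congrFun (congrFun hB i) j).symm.trans (of_ι N _).symm :)

open Cardinal in
theorem exists_ringAut_trivializes (m : Type) [Fintype m] [DecidableEq m] [IsAlgClosed F]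
    [CharZero F] (htr : ℵ₀ ≤ Algebra.trdeg ℚ F) :
    ∃ σ : F ≃+* F, Trivializes m (RingHom.id F) (σ : F →+* F) := by
  choose ι next hcomm htriv using exists_selfEmbedding_trivializes (F := F) m htr
  let σ : ℕ → F ≃+* F := fun i => next^[i] (RingEquiv.refl F)
  have hσ (i : ℕ) : σ (i + 1) = next (σ i) := Function.iterate_succ_apply' _ _ _
  obtain ⟨K, _, _, g, τ, hcard, hK⟩ := exists_limit_of_tower (m := m) (fun i => ι (σ i)) σ
    (fun i x => by rw [hσ, hcomm]) (fun i => by rw [hσ]; exact htriv _)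
  obtain ⟨e⟩ := IsAlgClosed.nonempty_ringEquiv_of_embedding htr g (by simpa using hcard)
  refine ⟨(e.trans τ).trans e.symm, fun A => ?_⟩
  obtain ⟨Z, hZ⟩ := hK.comp (e.symm : K →+* F)
    (ρ := (((e.trans τ).trans e.symm : F ≃+* F) : F →+* F)) (fun x => by simp)
    (GeneralLinearGroup.map (e : F →+* K) A)
  refine ⟨Z, Eq.trans ?_ hZ⟩
  ext i j
  simp

end Tower

/-! ### Reidemeister numbers -/

section Reidemeister

theorem reidemeisterNumber_eq_one {G : Type*} [Group G] {φ : G →* G}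
    (h : ∀ x, ∃ z, x = z * (φ z)⁻¹) : reidemeisterNumber φ = 1 := by
  have : Subsingleton (Quotient (twistedConjSetoid φ)) := by
    have h1 (x : G) : TwistedConj φ x 1 := by
      obtain ⟨z, hz⟩ := h x
      exact ⟨z, by rw [mul_one, ← hz]⟩
    refine ⟨fun a b => ?_⟩
    induction a, b using Quotient.inductionOn₂ with
    | h x y =>
      exact Quotient.sound ((twistedConj_equivalence φ).trans (h1 x)
        ((twistedConj_equivalence φ).symm (h1 y)))
  exact ENat.card_eq_one_iff_unique.2 ⟨⟨⟨Quotient.mk _ 1⟩, fun _ => Subsingleton.elim _ _⟩⟩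

theorem not_hasRInfinity_of_one_mem {G : Type*} [Group G] (h : 1 ∈ reidemeisterSpectrum G) :
    ¬ HasRInfinity G := by
  intro hG
  rw [show reidemeisterSpectrum G = {⊤} from hG] at h
  simp at h

variable {F : Type*} [Field F]

/-- A solution `Z` for a matrix `A` of determinant `1` has a `σ`-invariant determinant, and can hence
be rescaled in one column to have determinant `1`. -/
theorem Trivializes.exists_specialLinearGroup {m : Type*} [Fintype m] [DecidableEq m]
    [Nonempty m] {σ : F →+* F} (h : Trivializes m (RingHom.id F) σ) (A : SpecialLinearGroup m F) :
    ∃ Z : SpecialLinearGroup m F, A = Z * (SpecialLinearGroup.map σ Z)⁻¹ := by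
  obtain ⟨Z, hZ⟩ := h (A : GL m F)
  have hZ' : (A : Matrix m m F) * (Z : Matrix m m F).map σ = Z :=
    congrArg Units.val (eq_mul_inv_iff_mul_eq.1 hZ)
  have hdet : (Z : Matrix m m F).det ≠ 0 := (Z.isUnit.map Matrix.detMonoidHom).ne_zero
  have hfix : σ (Z : Matrix m m F).det = (Z : Matrix m m F).det := by
    have := congrArg Matrix.det hZ'
    rw [Matrix.det_mul, A.det_coe, one_mul] at this
    rw [RingHom.map_det]
    exact this
  let i₀ : m := Classical.arbitrary m
  let D : Matrix m m F := Matrix.diagonal (Function.update 1 i₀ (Z : Matrix m m F).det⁻¹)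
  have hD : D.map σ = D := by
    rw [Matrix.diagonal_map (map_zero σ)]
    congr 1
    ext i
    by_cases hi : i = i₀ <;> simp [hi, hfix]
  have hZD : ((Z : Matrix m m F) * D).det = 1 := by
    rw [Matrix.det_mul, Matrix.det_diagonal, Finset.prod_update_of_mem (Finset.mem_univ i₀)]
    simp [hdet]
  refine ⟨⟨_, hZD⟩, eq_mul_inv_iff_mul_eq.2 (Subtype.ext ?_)⟩
  change (A : Matrix m m F) * ((Z : Matrix m m F) * D).map σ = Z * D
  rw [Matrix.map_mul, hD, ← Matrix.mul_assoc, hZ']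

end Reidemeister

theorem theorem3p2 {F : Type*} [Field F] [IsAlgClosed F] [CharZero F]
    (htr : Cardinal.aleph0 ≤ Algebra.trdeg ℚ F) (n : ℕ) (hn : 2 ≤ n) :
    (∃ σ : F ≃+* F,
      reidemeisterNumber (glFieldAut n σ).toMonoidHom = 1 ∧
      reidemeisterNumber (slFieldAut n σ).toMonoidHom = 1) ∧
    1 ∈ reidemeisterSpectrum (Matrix.GeneralLinearGroup (Fin n) F) ∧
    1 ∈ reidemeisterSpectrum (Matrix.SpecialLinearGroup (Fin n) F) ∧
    ¬ HasRInfinity (Matrix.GeneralLinearGroup (Fin n) F) ∧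
    ¬ HasRInfinity (Matrix.SpecialLinearGroup (Fin n) F) := by
  have : Nonempty (Fin n) := ⟨⟨0, by omega⟩⟩
  obtain ⟨σ, hσ⟩ := exists_ringAut_trivializes (Fin n) htr
  have hGL : reidemeisterNumber (glFieldAut n σ).toMonoidHom = 1 :=
    reidemeisterNumber_eq_one hσ
  have hSL : reidemeisterNumber (slFieldAut n σ).toMonoidHom = 1 :=
    reidemeisterNumber_eq_one hσ.exists_specialLinearGroup
  exact ⟨⟨σ, hGL, hSL⟩, ⟨_, hGL⟩, ⟨_, hSL⟩, not_hasRInfinity_of_one_mem ⟨_, hGL⟩,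
    not_hasRInfinity_of_one_mem ⟨_, hSL⟩⟩
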